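/- Let $n,a,b\ge 0$ be integers. A contact manifold of dimension $2n+1$ is a smooth manifold $M$ of dimension $2n+1$ with a field $Q$ of hyperplanes which is locally of the form $Q=\ker\alpha$ for a smooth $1$-form $\alpha$ with $\alpha\wedge(d\alpha)^n$ nowhere zero. A local contactomorphism $\phi:(M,Q)\to(\tilde M,\tilde Q)$ is a local diffeomorphism with $d\phi(Q)=\tilde Q$. Write $\Omega^a(M)$ for the real vector space of smooth differential $a$-forms on $M$. A natural linear contact morphism $P:\Omega^a\to\Omega^b$ consists of a linear map $P_M:\Omega^a(M)\to\Omega^b(M)$ for every contact manifold $M$ of dimension $2n+1$, such that $P_M(\phi^*\omega)=\phi^*(P_{\tilde M}\,\omega)$ for every local contactomorphism $\phi:M\to\tilde M$ and every $\omega\in\Omega^a(\tilde M)$. **Proposition.** Let $\mathbb{R}^{2n+1}$, with coordinates $(x_1,\dots,x_n,y_1,\dots,y_n,z)$, be endowed with its standard contact structure $Q=\ker\bigl(dz+\sum_{i=1}^n x_i\,dy_i\bigr)$, and let $P:\Omega^a\to\Omega^b$ be a natural linear contact morphism. Then $P_{\mathbb{R}^{2n+1}}:\Omega^a(\mathbb{R}^{2n+1})\to\Omega^b(\mathbb{R}^{2n+1})$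 is a linear differential operator of finite order: there are an integer $r\ge 0$ and, for every $0\le k\le r$ and every $k$-tuple $I=(I_1,\dots,I_k)$ of coordinate directions, a smooth function $A_I$ on $\mathbb{R}^{2n+1}$ with values in the linear maps $\Lambda^a(\mathbb{R}^{2n+1})^*\to\Lambda^b(\mathbb{R}^{2n+1})^*$, such that $$(P_{\mathbb{R}^{2n+1}}\,\omega)(p)=\sum_{k=0}^{r}\ \sum_{I=(I_1,\dots,I_k)}A_I(p)\bigl(\partial_{I_1}\cdots\partial_{I_k}\,\omega(p)\bigr)$$ for all $\omega\in\Omega^a(\mathbb{R}^{2n+1})$ and all $p\in\mathbb{R}^{2n+1}$, where forms are differentiated as functions with values in the vector space $\Lambda^a(\mathbb{R}^{2n+1})^*$. -/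

import Mathlib

open Set Filter Topology
open scoped Manifold ContDiff

noncomputable section

namespace ContactForms

/-! ### Smooth differential forms on manifolds without boundary -/

section Forms

variable {E : Type*} [NormedAddCommGroup E] [NormedSpace ℝ E]
variable {M : Type*} [TopologicalSpace M] [ChartedSpace E M]
variable {N : Type*} [TopologicalSpace N] [ChartedSpace E N]

/-- A not necessarily smooth `a`-form on `M`: an alternating `a`-linear form on every tangent
space. -/
abbrev RoughForm (E : Type*) [NormedAddCommGroup E] [NormedSpace ℝ E]
    (M : Type*) [TopologicalSpace M] [ChartedSpace E M] (a : ℕ) : Type _ :=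
  (x : M) → (TangentSpace 𝓘(ℝ, E) x) [⋀^Fin a]→L[ℝ] ℝ

/-- The local expression of a form in a chart `e`, that is, its pull-back under `e⁻¹`. It is
meaningful on the target of `e`. -/
def inChart {a : ℕ} (e : OpenPartialHomeomorph M E) (θ : RoughForm E M a) :
    E → E [⋀^Fin a]→L[ℝ] ℝ :=
  fun y => (θ (e.symm y)).compContinuousLinearMap (mfderiv 𝓘(ℝ, E) 𝓘(ℝ, E) e.symm y)

/-- A form is smooth at `x` if its local expression is smooth at the image of `x`, for each chart of
the atlas around `x`. -/
def SmoothFormAt {a : ℕ} (θ : RoughForm E M a) (x : M) : Prop :=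
  ∀ e ∈ atlas E M, x ∈ e.source → ContDiffAt ℝ ∞ (inChart e θ) (e x)

/-- The real vector space `Ω^a(M)` of smooth differential `a`-forms on `M`. -/
def DiffForm (E : Type*) [NormedAddCommGroup E] [NormedSpace ℝ E]
    (M : Type*) [TopologicalSpace M] [ChartedSpace E M] (a : ℕ) :
    Submodule ℝ (RoughForm E M a) where
  carrier := {θ | ∀ x, SmoothFormAt θ x}
  add_mem' := by
    intro θ η hθ hη x e he hx
    exact (hθ x e he hx).add (hη x e he hx)
  zero_mem' := by
    intro x e _ _
    exact contDiffAt_const (c := (0 : E [⋀^Fin a]→L[ℝ] ℝ))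
  smul_mem' := by
    intro c θ hθ x e he hx
    exact (hθ x e he hx).const_smul c

/-- The pull-back `φ^*θ` of a form, `(φ^*θ)_x (v₁, …, v_a) = θ_{φ x} (dφ_x v₁, …, dφ_x v_a)`. -/
def roughPullback {a : ℕ} (φ : M → N) (θ : RoughForm E N a) : RoughForm E M a :=
  fun x => (θ (φ x)).compContinuousLinearMap (mfderiv 𝓘(ℝ, E) 𝓘(ℝ, E) φ x)

/-- The exterior derivative of a form, computed at `x` in the preferred chart around `x`. -/
def roughExtDeriv {a : ℕ} (θ : RoughForm E M a) : RoughForm E M (a + 1) :=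
  fun x => (extDeriv (inChart (chartAt E x) θ) (chartAt E x x)).compContinuousLinearMap
    (mfderiv 𝓘(ℝ, E) 𝓘(ℝ, E) (chartAt E x) x)

/-- The pull-back of a family of alternating forms by a family of linear maps is smooth if both
families are. -/
theorem contDiffAt_compContinuousLinearMap {a : ℕ} {f : E → E [⋀^Fin a]→L[ℝ] ℝ}
    {g : E → E →L[ℝ] E} {y : E} (hf : ContDiffAt ℝ ∞ f y) (hg : ContDiffAt ℝ ∞ g y) :
    ContDiffAt ℝ ∞ (fun z => (f z).compContinuousLinearMap (g z)) y := by
  have hT : ∃ T : ContinuousMultilinearMap ℝ (fun _ : Fin a => E) ℝ →L[ℝ] E [⋀^Fin a]→L[ℝ] ℝ,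
      ∀ h : E [⋀^Fin a]→L[ℝ] ℝ, T h.toContinuousMultilinearMap = h := by
    let T₀ : ContinuousMultilinearMap ℝ (fun _ : Fin a => E) ℝ →ₗ[ℝ] E [⋀^Fin a]→L[ℝ] ℝ :=
      { toFun := fun h => ((a.factorial : ℝ)⁻¹) • ContinuousMultilinearMap.alternatization h
        map_add' := by intro h k; simp
        map_smul' := by
          intro c h; ext v
          simp only [ContinuousAlternatingMap.smul_apply,
            ContinuousMultilinearMap.alternatization_apply_apply,
            smul_apply, RingHom.id_apply, smul_eq_mul, Finset.mul_sum]
          refine Finset.sum_congr rfl fun σ _ => ?_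
          simp only [Units.smul_def, zsmul_eq_mul]
          ring }
    refine ⟨T₀.mkContinuous 1 ?_, ?_⟩
    · intro h
      refine ContinuousAlternatingMap.opNorm_le_bound _ (by positivity) fun v => ?_
      simp only [T₀, LinearMap.coe_mk, AddHom.coe_mk, ContinuousAlternatingMap.smul_apply,
        ContinuousMultilinearMap.alternatization_apply_apply, smul_eq_mul, norm_mul, one_mul]
      have h1 : ‖∑ σ : Equiv.Perm (Fin a), Equiv.Perm.sign σ • h (v ∘ σ)‖ ≤
          ∑ σ : Equiv.Perm (Fin a), ‖h‖ * ∏ i, ‖v i‖ := by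
        refine norm_sum_le_of_le _ fun σ _ => ?_
        have h2 : ‖Equiv.Perm.sign σ • h (v ∘ σ)‖ = ‖h (v ∘ σ)‖ := by
          rcases Int.units_eq_one_or (Equiv.Perm.sign σ) with h | h <;> simp [h]
        rw [h2]
        refine (h.le_opNorm _).trans_eq ?_
        congr 1
        exact Equiv.prod_comp σ fun i => ‖v i‖
      rw [Finset.sum_const, Finset.card_univ, Fintype.card_perm, Fintype.card_fin,
        nsmul_eq_mul] at h1
      have h3 : (0 : ℝ) < a.factorial := by exact_mod_cast a.factorial_pos
      calc _ ≤ ‖(a.factorial : ℝ)⁻¹‖ * (a.factorial * (‖h‖ * ∏ i, ‖v i‖)) := by gcongr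
        _ = _ := by
          rw [norm_inv, Real.norm_of_nonneg h3.le]
          field_simp
    · intro h
      ext v
      have h3 : (a.factorial : ℝ) ≠ 0 := by exact_mod_cast a.factorial_ne_zero
      have : ∀ σ : Equiv.Perm (Fin a), Equiv.Perm.sign σ • h (v ∘ σ) = h v := by
        intro σ
        rw [show h (v ∘ σ) = Equiv.Perm.sign σ • h v from h.toAlternatingMap.map_perm v σ,
          smul_smul, Int.units_mul_self, one_smul]
      simp only [T₀, LinearMap.mkContinuous_apply, LinearMap.coe_mk, AddHom.coe_mk,
        ContinuousAlternatingMap.smul_apply,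
        ContinuousMultilinearMap.alternatization_apply_apply,
        ContinuousAlternatingMap.coe_toContinuousMultilinearMap, this, Finset.sum_const,
        Finset.card_univ, Fintype.card_perm, Fintype.card_fin, nsmul_eq_mul, smul_eq_mul]
      field_simp
  obtain ⟨T, hT⟩ := hT
  have key : ContDiffAt ℝ ∞ (fun z => T (ContinuousMultilinearMap.compContinuousLinearMap
      (f z).toContinuousMultilinearMap (fun _ => g z))) y := by
    refine T.contDiff.contDiffAt.comp y ?_
    have h1 := (ContinuousMultilinearMap.analyticAt_uncurry_compContinuousLinearMap (𝕜 := ℝ)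
      (Fm := fun _ : Fin a => E) (Em := fun _ : Fin a => E) (G := ℝ)
      (q := (fun _ => g y, (f y).toContinuousMultilinearMap))).contDiffAt (n := ∞)
    have h2 : ContDiffAt ℝ ∞ (fun z => ((fun _ => g z, (f z).toContinuousMultilinearMap) :
        (Fin a → E →L[ℝ] E) × ContinuousMultilinearMap ℝ (fun _ : Fin a => E) ℝ)) y := by
      refine ContDiffAt.prodMk (contDiffAt_pi.2 fun _ => hg) ?_
      exact (ContinuousAlternatingMap.toContinuousMultilinearMapCLM ℝ).contDiff.contDiffAt.comp y hf
    exact h1.comp y h2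
  refine key.congr_of_eventuallyEq (Filter.Eventually.of_forall fun z => ?_)
  exact (hT ((f z).compContinuousLinearMap (g z))).symm

/-- The pull-back of a smooth form by a smooth map is smooth. -/
theorem smooth_roughPullback [IsManifold 𝓘(ℝ, E) ∞ M] [IsManifold 𝓘(ℝ, E) ∞ N] {a : ℕ}
    {φ : M → N} (hφ : ContMDiff 𝓘(ℝ, E) 𝓘(ℝ, E) ∞ φ) {θ : RoughForm E N a}
    (hθ : ∀ y, SmoothFormAt θ y) (x : M) : SmoothFormAt (roughPullback φ θ) x := by
  intro e he hx
  set e' := chartAt E (φ x) with he'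
  have hM : IsManifold 𝓘(ℝ, E) 1 M := IsManifold.of_le (n := ∞) (by simp)
  have hN : IsManifold 𝓘(ℝ, E) 1 N := IsManifold.of_le (n := ∞) (by simp)
  have hφx : φ x ∈ e'.source := mem_chart_source E (φ x)
  have hex : e x ∈ e.target := e.map_source hx
  have hsx : e.symm (e x) = x := e.left_inv hx
  set ψ : E → E := e' ∘ φ ∘ e.symm with hψ
  have hφd : MDifferentiable 𝓘(ℝ, E) 𝓘(ℝ, E) φ := hφ.mdifferentiable (by simp)
  have hev : ∀ᶠ y in 𝓝 (e x), y ∈ e.target ∧ φ (e.symm y) ∈ e'.source := by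
    refine Filter.Eventually.and (e.open_target.mem_nhds hex) ?_
    have hc : ContinuousAt (fun y => φ (e.symm y)) (e x) :=
      hφ.continuous.continuousAt.comp (e.continuousAt_symm hex)
    exact hc.eventually_mem (e'.open_source.mem_nhds (by simpa [hsx] using hφx))
  have hψs : ContDiffAt ℝ ∞ ψ (e x) := by
    rw [← contMDiffAt_iff_contDiffAt]
    have h1 : ContMDiffAt 𝓘(ℝ, E) 𝓘(ℝ, E) ∞ e.symm (e x) :=
      contMDiffAt_symm_of_mem_maximalAtlas (IsManifold.subset_maximalAtlas he) hex
    have h2 : ContMDiffAt 𝓘(ℝ, E) 𝓘(ℝ, E) ∞ e' (φ (e.symm (e x))) :=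
      contMDiffAt_of_mem_maximalAtlas
        (IsManifold.subset_maximalAtlas (chart_mem_atlas E (φ x))) (by rw [hsx]; exact hφx)
    exact h2.comp (e x) ((hφ _).comp (e x) h1)
  have hloc : ContDiffAt ℝ ∞ (inChart e' θ) (ψ (e x)) := by
    have := hθ (φ x) e' (chart_mem_atlas E (φ x)) hφx
    simpa [hψ, hsx] using this
  have hmain : ContDiffAt ℝ ∞
      (fun z => (inChart e' θ (ψ z)).compContinuousLinearMap (fderiv ℝ ψ z)) (e x) :=
    contDiffAt_compContinuousLinearMap (hloc.comp (e x) hψs)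
      (hψs.fderiv_right (m := ∞) (by simp))
  refine hmain.congr_of_eventuallyEq ?_
  filter_upwards [hev] with y hy
  have hes : MDifferentiableAt 𝓘(ℝ, E) 𝓘(ℝ, E) e.symm y := mdifferentiableAt_atlas_symm he hy.1
  have he's : MDifferentiableAt 𝓘(ℝ, E) 𝓘(ℝ, E) e' (φ (e.symm y)) :=
    mdifferentiableAt_atlas (chart_mem_atlas E (φ x)) hy.2
  have hψy : MDifferentiableAt 𝓘(ℝ, E) 𝓘(ℝ, E) ψ y :=
    he's.comp y ((hφd _).comp y hes)
  have hψt : ψ y ∈ e'.target := e'.map_source hy.2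
  have he'ss : MDifferentiableAt 𝓘(ℝ, E) 𝓘(ℝ, E) e'.symm (ψ y) :=
    mdifferentiableAt_atlas_symm (chart_mem_atlas E (φ x)) hψt
  have hback : e'.symm (ψ y) = φ (e.symm y) := e'.left_inv hy.2
  have hcomp : ∀ v : E,
      mfderiv 𝓘(ℝ, E) 𝓘(ℝ, E) φ (e.symm y) (mfderiv 𝓘(ℝ, E) 𝓘(ℝ, E) e.symm y v) =
      mfderiv 𝓘(ℝ, E) 𝓘(ℝ, E) e'.symm (ψ y) (mfderiv 𝓘(ℝ, E) 𝓘(ℝ, E) ψ y v) := by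
    have h1 := mfderiv_comp y he'ss hψy
    have h2 := mfderiv_comp y (hφd (e.symm y)) hes
    have h3 : (e'.symm ∘ ψ) =ᶠ[𝓝 y] (φ ∘ e.symm) := by
      have hmem : e.target ∩ e.symm ⁻¹' (φ ⁻¹' e'.source) ∈ 𝓝 y := by
        refine inter_mem (e.open_target.mem_nhds hy.1) ?_
        have hc : ContinuousAt (fun y => φ (e.symm y)) y :=
          hφ.continuous.continuousAt.comp (e.continuousAt_symm hy.1)
        exact hc.eventually_mem (e'.open_source.mem_nhds hy.2)
      filter_upwards [hmem] with w hw
      exact e'.left_inv hw.2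
    have h4 := h3.mfderiv_eq (I := 𝓘(ℝ, E)) (I' := 𝓘(ℝ, E))
    intro v
    exact (congrArg (fun L : E →L[ℝ] E => L v) (h1.symm.trans (h4.trans h2))).symm
  have hgen : ∀ (q : N) (hq : q = φ (e.symm y)) (v : Fin a → E),
      (θ q : E [⋀^Fin a]→L[ℝ] ℝ) v = (θ (φ (e.symm y)) : E [⋀^Fin a]→L[ℝ] ℝ) v := by
    rintro q rfl v; rfl
  ext v
  refine Eq.trans ?_ (hgen _ hback _).symm
  change (θ (φ (e.symm y)) : E [⋀^Fin a]→L[ℝ] ℝ) _ = _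
  congr 1
  funext j
  have h0 : (mfderiv 𝓘(ℝ, E) 𝓘(ℝ, E) ψ y : E →L[ℝ] E) = fderiv ℝ ψ y := mfderiv_eq_fderiv
  refine (hcomp (v j)).trans ?_
  exact congrArg (fun L : E →L[ℝ] E =>
    (mfderiv 𝓘(ℝ, E) 𝓘(ℝ, E) e'.symm (ψ y) : E →L[ℝ] E) (L (v j))) h0

/-- The pull-back `φ^* : Ω^a(N) → Ω^a(M)` under a smooth map `φ : M → N`. -/
def pullback [IsManifold 𝓘(ℝ, E) ∞ M] [IsManifold 𝓘(ℝ, E) ∞ N] (a : ℕ)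
    (φ : M → N) (hφ : ContMDiff 𝓘(ℝ, E) 𝓘(ℝ, E) ∞ φ) :
    DiffForm E N a →ₗ[ℝ] DiffForm E M a where
  toFun θ := ⟨roughPullback φ θ.1, smooth_roughPullback hφ θ.2⟩
  map_add' _ _ := rfl
  map_smul' _ _ := rfl

end Forms

/-! ### Contact manifolds -/

/-- The value of `α ∧ β ∧ ⋯ ∧ β` (with `n` factors `β`), for a `1`-form `α` and a `2`-form `β` on a
vector space, on `2n+1` vectors `v none`, `v (some (i, 0))`, `v (some (i, 1))`, `i < n`, up to a
positive constant factor which depends on the normalization of the wedge product only. -/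
def wedgePow {V : Type*} [AddCommGroup V] [Module ℝ V] [TopologicalSpace V] (n : ℕ)
    (α : V [⋀^Fin 1]→L[ℝ] ℝ) (β : V [⋀^Fin 2]→L[ℝ] ℝ) (v : Option (Fin n × Fin 2) → V) : ℝ :=
  ∑ σ : Equiv.Perm (Option (Fin n × Fin 2)), ((Equiv.Perm.sign σ : ℤ) : ℝ) *
    (α ![v (σ none)] * ∏ i : Fin n, β ![v (σ (some (i, 0))), v (σ (some (i, 1)))])

/-- `ℝ^{2n+1}` with coordinates `(x, y, z)`, where `x, y ∈ ℝ^n` and `z ∈ ℝ`. -/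
abbrev Coord (n : ℕ) : Type := (Fin n → ℝ) × (Fin n → ℝ) × ℝ

/-- A hyperplane field `Q` on a manifold of dimension `2n+1` is a contact structure if locally
`Q = ker α` for a smooth `1`-form `α` such that `α ∧ (dα)^n` vanishes nowhere. -/
def IsContactStructure (n : ℕ) {M : Type*} [TopologicalSpace M] [ChartedSpace (Coord n) M]
    (Q : (x : M) → Submodule ℝ (TangentSpace 𝓘(ℝ, Coord n) x)) : Prop :=
  ∀ x : M, ∃ α : RoughForm (Coord n) M 1, ∀ᶠ y in 𝓝 x,
    SmoothFormAt α y ∧ (∀ v, v ∈ Q y ↔ α y ![v] = 0) ∧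
      ∃ v, wedgePow n (α y) (roughExtDeriv α y) v ≠ 0

/-- Contact manifolds of dimension `2n+1`: smooth Hausdorff second countable manifolds endowed with
a contact structure. -/
structure ContactManifold (n : ℕ) where
  carrier : Type
  [topology : TopologicalSpace carrier]
  [charts : ChartedSpace (Coord n) carrier]
  [smooth : IsManifold 𝓘(ℝ, Coord n) ∞ carrier]
  [hausdorff : T2Space carrier]
  [secondCountable : SecondCountableTopology carrier]
  /-- the field of contact hyperplanes -/
  Q : (x : carrier) → Submodule ℝ (TangentSpace 𝓘(ℝ, Coord n) x)
  contact : IsContactStructure n Q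

attribute [instance] ContactManifold.topology ContactManifold.charts ContactManifold.smooth
  ContactManifold.hausdorff ContactManifold.secondCountable

/-- The space `Ω^a(M)` of differential `a`-forms on a contact manifold. -/
abbrev Omega {n : ℕ} (a : ℕ) (M : ContactManifold n) :
    Submodule ℝ (RoughForm (Coord n) M.carrier a) :=
  DiffForm (Coord n) M.carrier a

/-- Local contactomorphisms `(M, Q) → (M', Q')`: local diffeomorphisms `φ` with `dφ(Q) = Q'`. -/
structure LocalContactomorphism {n : ℕ} (M M' : ContactManifold n) where
  toFun : M.carrier → M'.carrier
  localDiffeo : IsLocalDiffeomorph 𝓘(ℝ, Coord n) 𝓘(ℝ, Coord n) ∞ toFun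
  map_Q : ∀ x, (M.Q x).map (mfderiv 𝓘(ℝ, Coord n) 𝓘(ℝ, Coord n) toFun x).toLinearMap =
    M'.Q (toFun x)

/-- The linear map `φ^* : Ω^a(M') → Ω^a(M)` induced by a local contactomorphism `φ : M → M'`. -/
def LocalContactomorphism.pull {n : ℕ} {M M' : ContactManifold n} (φ : LocalContactomorphism M M') (a : ℕ) :
    Omega a M' →ₗ[ℝ] Omega a M :=
  pullback a φ.toFun φ.localDiffeo.contMDiff

/-- Natural linear contact morphisms `P : Ω^a → Ω^b` in dimension `2n+1`: natural transformations
between the functors `Ω^a` and `Ω^b` from the category of contact manifolds of dimension `2n+1` and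
local contactomorphisms to the category of real vector spaces. -/
structure NatContactMorphism (n a b : ℕ) where
  app : (M : ContactManifold n) → Omega a M →ₗ[ℝ] Omega b M
  naturality : ∀ {M M' : ContactManifold n} (φ : LocalContactomorphism M M') (θ : Omega a M'),
    app M (φ.pull a θ) = φ.pull b (app M' θ)

/-! ### The standard contact structure on `ℝ^{2n+1}` -/

/-- The linear form `dz + ∑ i, x_i dy_i` at the point `p = (x, y, z)`. -/
def stdLin (n : ℕ) (p : Coord n) : Coord n →L[ℝ] ℝ :=
  ContinuousLinearMap.snd ℝ (Fin n → ℝ) ℝ ∘L ContinuousLinearMap.snd ℝ (Fin n → ℝ) _ +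
    ∑ i : Fin n, p.1 i • (ContinuousLinearMap.proj (R := ℝ) (φ := fun _ : Fin n => ℝ) i ∘L
      ContinuousLinearMap.fst ℝ (Fin n → ℝ) ℝ ∘L ContinuousLinearMap.snd ℝ (Fin n → ℝ) _)

theorem stdLin_apply (n : ℕ) (p v : Coord n) :
    stdLin n p v = v.2.2 + ∑ i : Fin n, p.1 i * v.2.1 i := by
  simp [stdLin]

/-- The standard contact form `α = dz + ∑ i, x_i dy_i` on `ℝ^{2n+1}`. -/
def stdForm (n : ℕ) : RoughForm (Coord n) (Coord n) 1 :=
  fun p => ContinuousAlternatingMap.ofSubsingleton ℝ (Coord n) ℝ (0 : Fin 1) (stdLin n p)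

/-- `α ∧ β^n ≠ 0` if `α` and `β` take standard values on some tuple of vectors. -/
theorem exists_wedgePow_ne_zero {V : Type*} [AddCommGroup V] [Module ℝ V] [TopologicalSpace V]
    (n : ℕ) (α : V [⋀^Fin 1]→L[ℝ] ℝ) (β : V [⋀^Fin 2]→L[ℝ] ℝ) (v : Option (Fin n × Fin 2) → V)
    (h0 : α ![v none] = 1) (h1 : ∀ q, α ![v (some q)] = 0)
    (h2 : ∀ i j, β ![v (some (i, 0)), v (some (j, 1))] = if i = j then 1 else 0)
    (h3 : ∀ i j, β ![v (some (i, 1)), v (some (j, 0))] = if i = j then -1 else 0)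
    (h4 : ∀ i j c, β ![v (some (i, c)), v (some (j, c))] = 0) :
    wedgePow n α β v ≠ 0 := by
  have hterm : ∀ σ : Equiv.Perm (Option (Fin n × Fin 2)),
      0 ≤ ((Equiv.Perm.sign σ : ℤ) : ℝ) *
        (α ![v (σ none)] * ∏ i : Fin n, β ![v (σ (some (i, 0))), v (σ (some (i, 1)))]) := by
    intro σ
    by_cases hz : α ![v (σ none)] * ∏ i : Fin n, β ![v (σ (some (i, 0))), v (σ (some (i, 1)))] = 0
    · rw [hz, mul_zero]
    have hn : σ none = none := by
      cases hσ : σ none with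
      | none => rfl
      | some q => exact absurd (by rw [hσ, h1, zero_mul]) hz
    obtain ⟨τ, rfl⟩ : ∃ τ : Equiv.Perm (Fin n × Fin 2), σ = τ.optionCongr := by
      refine ⟨Equiv.removeNone σ, ?_⟩
      rw [map_equiv_removeNone, hn, Equiv.swap_self]
      rfl
    have hb : ∀ i, β ![v (some (τ (i, 0))), v (some (τ (i, 1)))] ≠ 0 := by
      intro i hi
      refine hz ?_
      rw [Finset.prod_eq_zero (Finset.mem_univ i), mul_zero]
      simpa using hi
    have hpair : ∀ i, (τ (i, 0)).1 = (τ (i, 1)).1 ∧ (τ (i, 0)).2 ≠ (τ (i, 1)).2 := by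
      intro i
      have := hb i
      rcases hp : τ (i, 0) with ⟨p, c⟩
      rcases hq : τ (i, 1) with ⟨q, d⟩
      rw [hp, hq] at this
      have hcd : c ≠ d := by rintro rfl; exact this (h4 p q c)
      refine ⟨?_, hcd⟩
      by_contra hpq
      have hpq' : p ≠ q := hpq
      fin_cases c <;> fin_cases d
      · exact hcd rfl
      · exact this (by simpa [hpq'] using h2 p q)
      · exact this (by simpa [hpq'] using h3 p q)
      · exact hcd rfl
    have hfst : ∀ i c, (τ (i, c)).1 = (τ (i, 0)).1 := by
      intro i c
      fin_cases c
      · rfl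
      · exact (hpair i).1.symm
    have hinj2 : ∀ i, Function.Injective fun c => (τ (i, c)).2 := by
      intro i c d hcd
      have : τ (i, c) = τ (i, d) := Prod.ext ((hfst i c).trans (hfst i d).symm) hcd
      exact (Prod.ext_iff.1 (τ.injective this)).2
    let f : Fin n → Equiv.Perm (Fin 2) := fun i =>
      Equiv.ofBijective (fun c => (τ (i, c)).2) (Finite.injective_iff_bijective.1 (hinj2 i))
    have hsurj : Function.Surjective fun i => (τ (i, 0)).1 := by
      intro p
      refine ⟨(τ.symm (p, 0)).1, ?_⟩
      have := hfst (τ.symm (p, 0)).1 (τ.symm (p, 0)).2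
      simpa using this.symm
    let ρ : Equiv.Perm (Fin n) :=
      Equiv.ofBijective (fun i => (τ (i, 0)).1) (Finite.surjective_iff_bijective.1 hsurj)
    have hτ : τ = Equiv.prodCongrLeft (fun _ : Fin 2 => ρ) * Equiv.prodCongrRight f := by
      ext1 ⟨i, c⟩
      exact Prod.ext (hfst i c) rfl
    have hsign : ((Equiv.Perm.sign τ : ℤ) : ℝ) = ∏ i, ((Equiv.Perm.sign (f i) : ℤ) : ℝ) := by
      rw [hτ, Equiv.Perm.sign_mul, Equiv.Perm.sign_prodCongrLeft, Equiv.Perm.sign_prodCongrRight,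
        Fin.prod_univ_two, Int.units_mul_self, one_mul]
      push_cast
      rfl
    have hβ : ∀ i, β ![v (some (τ (i, 0))), v (some (τ (i, 1)))] =
        ((Equiv.Perm.sign (f i) : ℤ) : ℝ) := by
      intro i
      have hf0 : f i 0 = (τ (i, 0)).2 := rfl
      have hf1 : f i 1 = (τ (i, 1)).2 := rfl
      obtain ⟨hp, hq⟩ := hpair i
      rcases hp0 : τ (i, 0) with ⟨p, c⟩
      rcases hp1 : τ (i, 1) with ⟨q, d⟩
      rw [hp0, hp1] at hp hq
      rw [hp0] at hf0
      rw [hp1] at hf1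
      simp only at hp hq hf0 hf1
      subst hp
      have key : ∀ g : Equiv.Perm (Fin 2), (g 0 = 0 → g 1 = 1 → Equiv.Perm.sign g = 1) ∧
          (g 0 = 1 → g 1 = 0 → Equiv.Perm.sign g = -1) := by decide
      fin_cases c <;> fin_cases d
      · exact absurd rfl hq
      · rw [(key (f i)).1 hf0 hf1]
        simpa using h2 p p
      · rw [(key (f i)).2 hf0 hf1]
        simpa using h3 p p
      · exact absurd rfl hq
    have hprod : ∏ i : Fin n, β ![v (τ.optionCongr (some (i, 0))),
        v (τ.optionCongr (some (i, 1)))] = ((Equiv.Perm.sign τ : ℤ) : ℝ) := by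
      rw [hsign]
      exact Finset.prod_congr rfl fun i _ => hβ i
    rw [hprod, Equiv.optionCongr_sign, hn, h0, one_mul]
    exact mul_self_nonneg _
  have hpos : 0 < wedgePow n α β v := by
    refine Finset.sum_pos' (fun σ _ => hterm σ) ⟨1, Finset.mem_univ _, ?_⟩
    simp [h0, h2]
  exact hpos.ne'

theorem stdForm_inChart (n : ℕ) (e : OpenPartialHomeomorph (Coord n) (Coord n))
    (he : e = OpenPartialHomeomorph.refl (Coord n)) :
    inChart e (stdForm n) =
      fun p => ContinuousAlternatingMap.ofSubsingleton ℝ (Coord n) ℝ (0 : Fin 1) (stdLin n p) := by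
  subst he
  funext p
  ext v
  have : (mfderiv 𝓘(ℝ, Coord n) 𝓘(ℝ, Coord n) (OpenPartialHomeomorph.refl (Coord n)).symm p :
      Coord n →L[ℝ] Coord n) = ContinuousLinearMap.id ℝ (Coord n) := mfderiv_id
  exact congrArg (fun L : Coord n →L[ℝ] Coord n => stdLin n p (L (v 0))) this

theorem contDiff_stdForm (n : ℕ) : ContDiff ℝ ∞ (fun p : Coord n =>
    ContinuousAlternatingMap.ofSubsingleton ℝ (Coord n) ℝ (0 : Fin 1) (stdLin n p)) := by
  refine (ContinuousAlternatingMap.ofSubsingletonLIE (𝕜 := ℝ) (E := Coord n) (F := ℝ)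
    (0 : Fin 1)).contDiff.comp (f := stdLin n) ?_
  unfold stdLin
  fun_prop

theorem roughExtDeriv_stdForm (n : ℕ) (p v w : Coord n) :
    (roughExtDeriv (E := Coord n) (stdForm n) p : (Coord n) [⋀^Fin 2]→L[ℝ] ℝ) ![v, w] =
      ∑ i, (v.1 i * w.2.1 i - w.1 i * v.2.1 i) := by
  have hid : (mfderiv 𝓘(ℝ, Coord n) 𝓘(ℝ, Coord n) (chartAt (Coord n) p) p :
      Coord n →L[ℝ] Coord n) = ContinuousLinearMap.id ℝ (Coord n) := mfderiv_id
  have h1 : (roughExtDeriv (E := Coord n) (stdForm n) p : (Coord n) [⋀^Fin 2]→L[ℝ] ℝ) ![v, w] =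
      extDeriv (inChart (chartAt (Coord n) p) (stdForm n)) p ![v, w] := by
    change extDeriv (inChart (chartAt (Coord n) p) (stdForm n)) p _ = _
    congr 1
    funext j
    exact congrArg (fun L : Coord n →L[ℝ] Coord n => L ((![v, w] : Fin 2 → Coord n) j)) hid
  rw [h1, stdForm_inChart n (chartAt (Coord n) p) rfl,
    extDeriv_apply ((contDiff_stdForm n).differentiable (by simp) p)]
  have h2 : ∀ u u' : Coord n, fderiv ℝ (fun q : Coord n => stdLin n q u) p u' =
      ∑ i, u'.1 i * u.2.1 i := by
    intro u u'
    let L : Coord n →L[ℝ] ℝ := ∑ i : Fin n, u.2.1 i •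
      (ContinuousLinearMap.proj (R := ℝ) (φ := fun _ : Fin n => ℝ) i ∘L
        ContinuousLinearMap.fst ℝ (Fin n → ℝ) _)
    have hL : (fun q : Coord n => stdLin n q u) = fun q => u.2.2 + L q := by
      funext q
      simp [stdLin_apply, L, mul_comm]
    rw [hL, fderiv_const_add, ContinuousLinearMap.fderiv]
    simp [L, mul_comm]
  have h3 := h2 w v
  have h4 := h2 v w
  rw [Fin.sum_univ_two, Finset.sum_sub_distrib, ← h3, ← h4, sub_eq_add_neg]
  simp only [Fin.val_zero, pow_zero, one_smul, Fin.val_one, pow_one, neg_smul]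
  rfl

theorem std_isContactStructure (n : ℕ) :
    IsContactStructure n (M := Coord n) (fun p => LinearMap.ker (stdLin n p).toLinearMap) := by
  intro x
  refine ⟨stdForm n, Filter.Eventually.of_forall fun p => ⟨?_, ?_, ?_⟩⟩
  · intro e he _
    rw [stdForm_inChart n e (by simpa using he)]
    exact (contDiff_stdForm n).contDiffAt
  · intro v
    exact LinearMap.mem_ker
  · refine ⟨fun q => match q with
      | none => ((0, 0, 1) : Coord n)
      | some (i, 0) => ((Pi.single i 1, 0, 0) : Coord n)
      | some (i, 1) => ((0, Pi.single i 1, -p.1 i) : Coord n), ?_⟩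
    have hα : ∀ v : Coord n, (stdForm n p : (Coord n) [⋀^Fin 1]→L[ℝ] ℝ) ![v] =
        v.2.2 + ∑ i : Fin n, p.1 i * v.2.1 i := stdLin_apply n p
    refine exists_wedgePow_ne_zero (V := Coord n) n _ _ _ ?_ ?_ ?_ ?_ ?_
    · exact (hα _).trans (by simp)
    · rintro ⟨i, c⟩
      fin_cases c
      · exact (hα _).trans (by simp)
      · exact (hα _).trans (by simp [Pi.single_apply])
    · intro i j
      exact (roughExtDeriv_stdForm n p _ _).trans (by simp [Pi.single_apply, eq_comm])
    · intro i j
      refine (roughExtDeriv_stdForm n p _ _).trans ?_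
      by_cases h : i = j <;> simp [Pi.single_apply, h, eq_comm]
    · intro i j c
      fin_cases c
      · exact (roughExtDeriv_stdForm n p _ _).trans (by simp)
      · exact (roughExtDeriv_stdForm n p _ _).trans (by simp)

/-- `ℝ^{2n+1}` with its standard contact structure `Q = ker (dz + ∑ i, x_i dy_i)`. -/
def stdContact (n : ℕ) : ContactManifold n where
  carrier := Coord n
  Q := fun p => LinearMap.ker (stdLin n p).toLinearMap
  contact := std_isContactStructure n

/-! ### Differential operators -/

/-- The standard basis vectors `∂/∂x_i`, `∂/∂y_i`, `∂/∂z` of `ℝ^{2n+1}`. -/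
def stdVec (n : ℕ) : Fin n ⊕ Fin n ⊕ Unit → Coord n
  | .inl i => (Pi.single i 1, 0, 0)
  | .inr (.inl i) => (0, Pi.single i 1, 0)
  | .inr (.inr _) => (0, 0, 1)

/-- The iterated partial derivative `∂_{I 0} ⋯ ∂_{I (k-1)} θ` of an `a`-form `θ` on `ℝ^{2n+1}`,
viewed as a function with values in the fixed vector space of alternating `a`-linear forms on
`ℝ^{2n+1}`. -/
def partialDeriv {n a k : ℕ} (I : Fin k → Fin n ⊕ Fin n ⊕ Unit)
    (θ : Coord n → (Coord n) [⋀^Fin a]→L[ℝ] ℝ) (p : Coord n) : (Coord n) [⋀^Fin a]→L[ℝ] ℝ :=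
  iteratedFDeriv ℝ k θ p (fun j => stdVec n (I j))

/-- A linear operator `D : Ω^a(ℝ^{2n+1}) → Ω^b(ℝ^{2n+1})` is a linear differential operator of order
at most `r` if `(Dθ)(p) = ∑_{k ≤ r} ∑_{I} A_I(p) (∂_{I 0} ⋯ ∂_{I (k-1)} θ (p))`, where `I` ranges over
the `k`-tuples of coordinate directions and the coefficients `A_I` are smooth functions with values
in the linear maps from `a`-forms to `b`-forms on the vector space `ℝ^{2n+1}`. -/
def IsDiffOpOfOrderLE {n a b : ℕ} (r : ℕ)
    (D : Omega a (stdContact n) →ₗ[ℝ] Omega b (stdContact n)) : Prop :=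
  ∃ A : (k : ℕ) → (Fin k → Fin n ⊕ Fin n ⊕ Unit) → Coord n →
      ((Coord n) [⋀^Fin a]→L[ℝ] ℝ) →L[ℝ] ((Coord n) [⋀^Fin b]→L[ℝ] ℝ),
    (∀ k I, ContDiff ℝ ∞ (A k I)) ∧
    ∀ (θ : Omega a (stdContact n)) (p : Coord n),
      (D θ).1 p = ∑ k ∈ Finset.range (r + 1), ∑ I : Fin k → Fin n ⊕ Fin n ⊕ Unit,
        A k I p (partialDeriv I (fun q : Coord n => θ.1 q) p)

end ContactForms

end

/-! Neither locality nor continuity of `P` is assumed; finite order is forced by contact dilations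
alone. The contraction φ(x, y, z) = (x/2, y/2, z/4) preserves the contact structure and fixes the
origin. There, φ^* multiplies the component of a b-form on a tuple of basis vectors by 2^(-j), where
the weight j of the tuple counts each z-direction twice; hence j ≤ 2b. Let θ have vanishing 2b-jet
at 0 and fix a tuple of weight j. The series G = ∑ 2^(jk) (φ^k)^*θ converges with all derivatives,
uniformly on balls, because the vanishing of θ to order j outweighs the factors 2^(jk)
(`exists_contDiff_eq_add_comp`). So G is a smooth form with G = θ + 2^j φ^*G. Linearity and
naturality give PG = Pθ + 2^j φ^*PG. In the chosen component at 0 the two terms with PG are equal,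
so that component of Pθ vanishes (`NatContactMorphism.apply_zero_eq_zero`). Translations corrected
by a shear are contactomorphisms moving 0 to any point p, so Pθ(p) depends only on the 2b-jet of θ
at p (`NatContactMorphism.apply_eq_zero`). Replacing θ by its Taylor polynomial at p and expanding
in monomials with constant coefficient forms yields the operator. Its coefficients are smooth
because `P` maps each monomial form to a smooth form. -/

noncomputable section

namespace ContactForms

section Analysis

variable {E F : Type} [NormedAddCommGroup E] [NormedSpace ℝ E]
  [NormedAddCommGroup F] [NormedSpace ℝ F]

/-! ### Smooth series and a contracting functional equation -/

/-- A series of smooth functions is smooth if on each ball the derivatives of each order are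
dominated by a summable sequence. -/
theorem contDiff_tsum_of_summable_on_balls [CompleteSpace F] (f : ℕ → E → F)
    (hf : ∀ k, ContDiff ℝ ∞ (f k))
    (hb : ∀ (m : ℕ) (R : ℝ), ∃ v : ℕ → ℝ, Summable v ∧
      ∀ k, ∀ x ∈ Metric.ball (0 : E) R, ‖iteratedFDeriv ℝ m (f k) x‖ ≤ v k) :
    ContDiff ℝ ∞ (fun x => ∑' k, f k x) := by
  rw [contDiff_infty]
  intro N
  -- `F` must vary: the induction hypothesis is applied to the series of derivatives, with values in
  -- `E →L[ℝ] F`.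
  induction N generalizing F with
  | zero =>
    rw [Nat.cast_zero, contDiff_zero, continuous_iff_continuousAt]
    intro x
    obtain ⟨v, hv, hbv⟩ := hb 0 (‖x‖ + 1)
    have hc : ContinuousOn (fun x => ∑' k, f k x) (Metric.ball (0 : E) (‖x‖ + 1)) :=
      continuousOn_tsum (fun k => (hf k).continuous.continuousOn) hv
        fun k y hy => by simpa using hbv k y hy
    exact hc.continuousAt (Metric.isOpen_ball.mem_nhds (by simp))
  | succ N ih =>
    have hd : ∀ x, HasFDerivAt (fun x => ∑' k, f k x) (∑' k, fderiv ℝ (f k) x) x := by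
      intro x
      obtain ⟨v, hv, hbv⟩ := hb 1 (‖x‖ + 1)
      obtain ⟨w, hw, hbw⟩ := hb 0 (‖x‖ + 1)
      have hx : x ∈ Metric.ball (0 : E) (‖x‖ + 1) := by simp
      refine hasFDerivAt_tsum_of_isPreconnected hv Metric.isOpen_ball
        (convex_ball (0 : E) (‖x‖ + 1)).isPreconnected
        (fun k y _ => ((hf k).differentiable (by simp) y).hasFDerivAt)
        (fun k y hy => ?_) hx ?_ hx
      · rw [← norm_iteratedFDeriv_one]
        exact hbv k y hy
      · exact Summable.of_norm_bounded hw fun k => by simpa using hbw k x hx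
    push_cast
    rw [contDiff_succ_iff_fderiv]
    refine ⟨fun x => (hd x).differentiableAt, by simp, ?_⟩
    have he : fderiv ℝ (fun x => ∑' k, f k x) = fun x => ∑' k, fderiv ℝ (f k) x :=
      funext fun x => (hd x).fderiv
    rw [he]
    refine ih (fun k => fderiv ℝ (f k)) (fun k => (hf k).fderiv_right (by simp)) fun m R => ?_
    obtain ⟨v, hv, hbv⟩ := hb (m + 1) R
    exact ⟨v, hv, fun k x hx => by rw [norm_iteratedFDeriv_fderiv]; exact hbv k x hx⟩

/-- If the derivatives of orders `0, …, r` of a smooth function vanish at the origin, then its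
`m`-th derivative is `O(‖q‖ ^ (r + 1 - m))`. -/
theorem exists_norm_iteratedFDeriv_le [FiniteDimensional ℝ E] {f : E → F} (hf : ContDiff ℝ ∞ f)
    (r : ℕ) (h0 : ∀ m ≤ r, iteratedFDeriv ℝ m f 0 = 0) (m : ℕ) (R : ℝ) :
    ∃ C, 0 ≤ C ∧ ∀ q, ‖q‖ ≤ R → ‖iteratedFDeriv ℝ m f q‖ ≤ C * ‖q‖ ^ (r + 1 - m) := by
  -- The truncated difference is 0 for m > r, where compactness of the ball gives a bound. Smaller m
  -- follow by descending induction, each use of the mean value inequality gaining one power of ‖q‖.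
  generalize hd : r + 1 - m = d
  induction d generalizing m with
  | zero =>
    obtain ⟨C, hC⟩ := (isCompact_closedBall (0 : E) R).exists_bound_of_continuousOn
      (hf.continuous_iteratedFDeriv (m := m) (by exact_mod_cast le_top)).continuousOn
    exact ⟨max C 0, le_max_right _ _, fun q hq => by
      simpa using Or.inl (hC q (by simpa using hq))⟩
  | succ d ih =>
    obtain ⟨C, hC0, hC⟩ := ih (m + 1) (by omega)
    refine ⟨C, hC0, fun q hq => ?_⟩
    have hdiff : Differentiable ℝ (iteratedFDeriv ℝ m f) :=
      hf.differentiable_iteratedFDeriv (by exact_mod_cast ENat.natCast_lt_top m)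
    -- On the ball of radius ‖q‖, rather than R, the bound on the next derivative is uniformly
    -- C‖q‖^d.
    have hmv := Convex.norm_image_sub_le_of_norm_fderiv_le (𝕜 := ℝ) (f := iteratedFDeriv ℝ m f)
      (C := C * ‖q‖ ^ d) (s := Metric.closedBall (0 : E) ‖q‖) (x := 0) (y := q)
      (fun x _ => hdiff x) (fun x hx => ?_) (convex_closedBall _ _) (by simp) (by simp)
    · rw [h0 m (by omega), sub_zero, sub_zero] at hmv
      rwa [pow_succ, ← mul_assoc]
    · have hx' : ‖x‖ ≤ ‖q‖ := by simpa using hx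
      rw [norm_fderiv_iteratedFDeriv]
      exact (hC x (hx'.trans hq)).trans (by gcongr)

/-- The equation `g = f + Φ ∘ g ∘ S` has a smooth solution if `S` contracts by the factor `1 / 2`,
`Φ` expands by the factor `2 ^ j` at most and `f` vanishes to order `j` at the origin. -/
theorem exists_contDiff_eq_add_comp [FiniteDimensional ℝ E] [CompleteSpace F]
    {f : E → F} (hf : ContDiff ℝ ∞ f) (j : ℕ) (h0 : ∀ m ≤ j, iteratedFDeriv ℝ m f 0 = 0)
    (S : E →L[ℝ] E) (hS : ‖S‖ ≤ 1 / 2) (Φ : F →L[ℝ] F) (hΦ : ‖Φ‖ ≤ 2 ^ j) :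
    ∃ g : E → F, ContDiff ℝ ∞ g ∧ ∀ x, g x = f x + Φ (g (S x)) := by
  have hSk : ∀ k, ‖S ^ k‖ ≤ (1 / 2 : ℝ) ^ k := by
    intro k
    induction k with
    | zero => simpa [ContinuousLinearMap.one_def] using ContinuousLinearMap.norm_id_le (𝕜 := ℝ) (E := E)
    | succ k ih =>
      rw [pow_succ, pow_succ]
      exact (ContinuousLinearMap.opNorm_comp_le _ _).trans (by gcongr)
  have hΦk : ∀ k, ‖Φ ^ k‖ ≤ ((2 : ℝ) ^ j) ^ k := by
    intro k
    induction k with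
    | zero => simpa [ContinuousLinearMap.one_def] using ContinuousLinearMap.norm_id_le (𝕜 := ℝ) (E := F)
    | succ k ih =>
      rw [pow_succ, pow_succ]
      exact (ContinuousLinearMap.opNorm_comp_le _ _).trans (by gcongr)
  -- Iterating the equation suggests the solution g = ∑ Φ^k ∘ f ∘ S^k.
  let u : ℕ → E → F := fun k x => (Φ ^ k) (f ((S ^ k) x))
  have hu : ∀ k, ContDiff ℝ ∞ (u k) := fun k =>
    (Φ ^ k).contDiff.comp (hf.comp (S ^ k).contDiff)
  have hb : ∀ (m : ℕ) (R : ℝ), ∃ v : ℕ → ℝ, Summable v ∧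
      ∀ k, ∀ x ∈ Metric.ball (0 : E) R, ‖iteratedFDeriv ℝ m (u k) x‖ ≤ v k := by
    intro m R
    obtain ⟨C, hC0, hC⟩ := exists_norm_iteratedFDeriv_le hf j h0 m R
    -- The m-th derivative of the k-th term collects 2^(jk) from Φ, 2^(-k(j+1-m)) from the vanishing
    -- of f, and 2^(-km) from the chain rule; a factor 2^(-k) is left over.
    refine ⟨fun k => C * R ^ (j + 1 - m) * (1 / 2 : ℝ) ^ k,
      (summable_geometric_of_lt_one (by norm_num) (by norm_num)).mul_left _, fun k x hx => ?_⟩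
    have hxR : ‖x‖ ≤ R := by simpa using (Metric.mem_ball.1 hx).le
    have hR : 0 ≤ R := (norm_nonneg x).trans hxR
    have hSx : ‖(S ^ k) x‖ ≤ (1 / 2 : ℝ) ^ k * R :=
      ((S ^ k).le_opNorm x).trans (by gcongr; exact hSk k)
    have hSx' : ‖(S ^ k) x‖ ≤ R := by
      refine hSx.trans (mul_le_of_le_one_left hR (pow_le_one₀ (by norm_num) (by norm_num)))
    have h1 : ‖iteratedFDeriv ℝ m (u k) x‖ ≤ ‖Φ ^ k‖ *
        ‖iteratedFDeriv ℝ m (f ∘ (S ^ k)) x‖ :=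
      (Φ ^ k).norm_iteratedFDeriv_comp_left (hf.comp (S ^ k).contDiff).contDiffAt
        (by exact_mod_cast le_top)
    rw [(S ^ k).iteratedFDeriv_comp_right hf x (by exact_mod_cast le_top)] at h1
    have h2 := (iteratedFDeriv ℝ m f ((S ^ k) x)).norm_compContinuousLinearMap_le
      (fun _ => S ^ k)
    rw [Finset.prod_const, Finset.card_univ, Fintype.card_fin] at h2
    calc ‖iteratedFDeriv ℝ m (u k) x‖
        ≤ ((2 : ℝ) ^ j) ^ k * ((C * ((1 / 2 : ℝ) ^ k * R) ^ (j + 1 - m)) *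
            ((1 / 2 : ℝ) ^ k) ^ m) := by
          refine h1.trans (mul_le_mul (hΦk k) (h2.trans ?_) (norm_nonneg _) (by positivity))
          refine mul_le_mul ((hC _ hSx').trans ?_) ?_ (by positivity) (by positivity)
          · gcongr
          · gcongr
            exact hSk k
      _ = C * R ^ (j + 1 - m) * (((2 : ℝ) ^ j) ^ k * ((1 / 2 : ℝ) ^ k) ^ (j + 1 - m + m)) := by
          rw [mul_pow, pow_add]; ring
      -- Only an inequality, since j + 1 - m is truncated when m > j + 1.
      _ ≤ C * R ^ (j + 1 - m) * (((2 : ℝ) ^ j) ^ k * ((1 / 2 : ℝ) ^ k) ^ (j + 1)) := by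
          have : ((1 / 2 : ℝ) ^ k) ^ (j + 1 - m + m) ≤ ((1 / 2 : ℝ) ^ k) ^ (j + 1) :=
            pow_le_pow_of_le_one (by positivity) (pow_le_one₀ (by norm_num) (by norm_num))
              (by omega)
          gcongr
      _ = C * R ^ (j + 1 - m) * (1 / 2 : ℝ) ^ k := by
          congr 1
          rw [pow_succ, ← mul_assoc, ← pow_mul, ← pow_mul, mul_comm k j, ← mul_pow]
          norm_num
  refine ⟨fun x => ∑' k, u k x, contDiff_tsum_of_summable_on_balls u hu hb, fun x => ?_⟩
  have hsum : ∀ x, Summable fun k => u k x := by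
    intro x
    obtain ⟨v, hv, hbv⟩ := hb 0 (‖x‖ + 1)
    exact Summable.of_norm_bounded hv fun k => by simpa using hbv k x (by simp)
  change ∑' k, u k x = f x + Φ (∑' k, u k (S x))
  rw [(hsum x).tsum_eq_zero_add, Φ.map_tsum (hsum (S x))]
  congr 1
  refine tsum_congr fun k => ?_
  simp only [u, pow_succ' Φ k, pow_succ S k]
  rfl

/-! ### Symmetry of derivatives and Taylor polynomials -/

/-- The iterated derivatives of a smooth function are symmetric. -/
theorem iteratedFDeriv_comp_perm_of_contDiff {f : E → F} (hf : ContDiff ℝ ∞ f) (k : ℕ)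
    (σ : Equiv.Perm (Fin k)) (x : E) (v : Fin k → E) :
    iteratedFDeriv ℝ k f x (v ∘ σ) = iteratedFDeriv ℝ k f x v := by
  have hd : ∀ k, ContDiff ℝ ∞ (iteratedFDeriv ℝ k f) := fun k =>
    hf.iteratedFDeriv_right (by exact_mod_cast le_top)
  have heval : ∀ k (x : E) (v : Fin (k + 1) → E), iteratedFDeriv ℝ (k + 1) f x v =
      fderiv ℝ (fun y => iteratedFDeriv ℝ k f y (Fin.tail v)) x (v 0) := by
    intro k x v
    rw [iteratedFDeriv_succ_apply_left, fderiv_continuousMultilinear_apply_const_apply]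
    exact (hd k).differentiable (by simp) x
  -- Adjacent transpositions generate all permutations. Swapping the first two slots is the symmetry
  -- of the second derivative of a lower iterated derivative; any other adjacent swap leaves slot 0
  -- alone and follows by differentiating the inductive identity.
  have hadj : ∀ k (i : Fin k) (x : E) (v : Fin (k + 1) → E),
      iteratedFDeriv ℝ (k + 1) f x (v ∘ Equiv.swap i.castSucc i.succ) =
        iteratedFDeriv ℝ (k + 1) f x v := by
    intro k
    induction k with
    | zero => exact fun i => i.elim0
    | succ k ih =>
      intro i x v
      rcases Fin.eq_zero_or_eq_succ i with rfl | ⟨i, rfl⟩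
      · have hsnd : ∀ v : Fin (k + 2) → E, iteratedFDeriv ℝ (k + 2) f x v =
            fderiv ℝ (fderiv ℝ (iteratedFDeriv ℝ k f)) x (v 0) (v 1)
              (Fin.tail (Fin.tail v)) := by
          intro v
          rw [heval]
          have hfd : Differentiable ℝ (fderiv ℝ (iteratedFDeriv ℝ k f)) :=
            ((hd k).fderiv_right (m := ∞) (by simp)).differentiable (by simp)
          have h1 : (fun y => iteratedFDeriv ℝ (k + 1) f y (Fin.tail v)) =
              fun y => (fderiv ℝ (iteratedFDeriv ℝ k f) y (v 1)) (Fin.tail (Fin.tail v)) := by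
            funext y
            rw [iteratedFDeriv_succ_apply_left]
            rfl
          rw [h1, fderiv_continuousMultilinear_apply_const_apply
            ((hfd x).clm_apply (differentiableAt_const _)),
            fderiv_clm_apply (hfd x) (differentiableAt_const _)]
          simp
        rw [hsnd, hsnd]
        have hsym : IsSymmSndFDerivAt ℝ (iteratedFDeriv ℝ k f) x :=
          (hd k).contDiffAt.isSymmSndFDerivAt
            (by
              rw [minSmoothness_of_isRCLikeNormedField]
              exact WithTop.coe_le_coe.2 (le_top : (2 : ℕ∞) ≤ ⊤))
        have hs0 : (v ∘ Equiv.swap (0 : Fin (k + 1)).castSucc (0 : Fin (k + 1)).succ) 0 = v 1 := by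
          simp
        have hs1 : (v ∘ Equiv.swap (0 : Fin (k + 1)).castSucc (0 : Fin (k + 1)).succ) 1 = v 0 := by
          simp
        have hs2 : Fin.tail (Fin.tail
            (v ∘ Equiv.swap (0 : Fin (k + 1)).castSucc (0 : Fin (k + 1)).succ)) =
            Fin.tail (Fin.tail v) := by
          funext l
          simp only [Fin.tail, Function.comp_apply]
          rw [Equiv.swap_apply_of_ne_of_ne]
          · simp
          · simp only [ne_eq, Fin.succ_inj]
            simp
        rw [hs0, hs1, hs2, hsym.eq]
      · rw [heval, heval]
        have hs0 : (v ∘ Equiv.swap i.succ.castSucc i.succ.succ) 0 = v 0 := by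
          simp only [Function.comp_apply]
          rw [Equiv.swap_apply_of_ne_of_ne] <;> simp [Fin.ext_iff]
        have ht : Fin.tail (v ∘ Equiv.swap i.succ.castSucc i.succ.succ) =
            Fin.tail v ∘ Equiv.swap i.castSucc i.succ := by
          funext l
          simp only [Fin.tail, Function.comp_apply, ← Fin.succ_castSucc]
          rw [(Fin.succ_injective _).swap_apply]
        rw [hs0, ht]
        simp only [ih]
  cases k with
  | zero => congr 1; exact Subsingleton.elim _ _
  | succ k =>
    have hmem : σ ∈ Submonoid.closure
        (Set.range fun i : Fin k => Equiv.swap i.castSucc i.succ) := by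
      rw [Equiv.Perm.mclosure_swap_castSucc_succ]
      exact Submonoid.mem_top σ
    induction hmem using Submonoid.closure_induction generalizing v with
    | mem τ hτ =>
      obtain ⟨i, rfl⟩ := hτ
      exact hadj k i x v
    | one => rfl
    | mul τ τ' _ _ h h' =>
      exact (h' (v ∘ τ)).trans (h v)

/-- The Taylor polynomial of order `r` of `f` at `p`. -/
def taylorPoly (f : E → F) (r : ℕ) (p q : E) : F :=
  ∑ k ∈ Finset.range (r + 1), (k.factorial : ℝ)⁻¹ • iteratedFDeriv ℝ k f p (fun _ => q - p)

theorem contDiff_taylorPoly (f : E → F) (r : ℕ) (p : E) : ContDiff ℝ ∞ (taylorPoly f r p) := by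
  unfold taylorPoly
  refine ContDiff.sum fun k _ => ContDiff.const_smul _ ?_
  exact (iteratedFDeriv ℝ k f p).contDiff.comp
    (contDiff_pi.2 fun _ => contDiff_id.sub contDiff_const)

/-- The polynomial is a finite power series around p, whose m-th derivative there sums the m-th
coefficient over all permutations of its arguments. The coefficient is symmetric, so the m! equal
terms cancel the factor 1/m!. -/
theorem iteratedFDeriv_taylorPoly [CompleteSpace F] {f : E → F} (hf : ContDiff ℝ ∞ f) (r : ℕ)
    (p : E) {m : ℕ} (hm : m ≤ r) :
    iteratedFDeriv ℝ m (taylorPoly f r p) p = iteratedFDeriv ℝ m f p := by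
  let s : FormalMultilinearSeries ℝ E F := fun k =>
    if k ≤ r then (k.factorial : ℝ)⁻¹ • iteratedFDeriv ℝ k f p else 0
  have hs : ∀ k, r + 1 ≤ k → s k = 0 := fun k hk => if_neg (by omega)
  have h1 := (s.hasFiniteFPowerSeriesOnBall_of_finite hs).toHasFPowerSeriesOnBall.comp_sub p
  have h2 : (fun q => s.sum (q - p)) = taylorPoly f r p := by
    funext q
    rw [s.sum_of_finite hs]
    refine Finset.sum_congr rfl fun k hk => ?_
    have hk' : k ≤ r := by simpa [Nat.lt_succ_iff] using hk
    simp [s, hk']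
  rw [h2, zero_add] at h1
  ext v
  rw [h1.iteratedFDeriv_eq_sum_of_completeSpace]
  have h3 : ∀ σ : Equiv.Perm (Fin m), s m (fun i => v (σ i)) =
      (m.factorial : ℝ)⁻¹ • iteratedFDeriv ℝ m f p v := by
    intro σ
    simp only [s, hm, if_true, smul_apply]
    congr 1
    exact iteratedFDeriv_comp_perm_of_contDiff hf m σ p v
  have hne : (m.factorial : ℝ) ≠ 0 := by exact_mod_cast m.factorial_ne_zero
  simp only [h3, Finset.sum_const, Finset.card_univ, Fintype.card_perm, Fintype.card_fin]
  rw [← Nat.cast_smul_eq_nsmul ℝ, smul_smul, mul_inv_cancel₀ hne, one_smul]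

end Analysis

section StandardForms

variable {n a b : ℕ}

/-! ### Forms on ℝ^{2n+1} as vector-valued functions -/

/-- The standard basis of `ℝ^{2n+1}`. -/
def stdBasis (n : ℕ) : Module.Basis (Fin n ⊕ Fin n ⊕ Unit) ℝ (Coord n) :=
  (Pi.basisFun ℝ (Fin n)).prod ((Pi.basisFun ℝ (Fin n)).prod (Module.Basis.singleton Unit ℝ))

theorem stdBasis_apply (n : ℕ) (i : Fin n ⊕ Fin n ⊕ Unit) : stdBasis n i = stdVec n i := by
  rcases i with i | i | i <;> simp [stdBasis, stdVec, Module.Basis.prod_apply]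
  rfl

/-- Makes linear maps out of this space continuous, and lets smoothness of operator-valued functions
be tested on each fixed form. -/
instance finiteDimensional_alternating (n a : ℕ) :
    FiniteDimensional ℝ ((Coord n) [⋀^Fin a]→L[ℝ] ℝ) := by
  let T : ((Coord n) [⋀^Fin a]→L[ℝ] ℝ) →ₗ[ℝ] MultilinearMap ℝ (fun _ : Fin a => Coord n) ℝ :=
    { toFun := fun η => η.toMultilinearMap
      map_add' := fun _ _ => rfl
      map_smul' := fun _ _ => rfl }
  refine FiniteDimensional.of_injective T fun η η' h => ?_
  ext v
  exact congrArg (fun μ : MultilinearMap ℝ (fun _ : Fin a => Coord n) ℝ => μ v) h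

theorem inChart_refl (θ : RoughForm (Coord n) (Coord n) a) :
    inChart (OpenPartialHomeomorph.refl (Coord n)) θ = θ := by
  funext p
  ext v
  have : (mfderiv 𝓘(ℝ, Coord n) 𝓘(ℝ, Coord n) (OpenPartialHomeomorph.refl (Coord n)).symm p :
      Coord n →L[ℝ] Coord n) = ContinuousLinearMap.id ℝ (Coord n) := mfderiv_id
  exact congrArg (fun L : Coord n →L[ℝ] Coord n =>
    (θ p : (Coord n) [⋀^Fin a]→L[ℝ] ℝ) (fun j => L (v j))) this

/-- The smooth form on `ℝ^{2n+1}` given by a smooth function with values in alternating forms. -/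
def formOf (f : Coord n → (Coord n) [⋀^Fin a]→L[ℝ] ℝ) (hf : ContDiff ℝ ∞ f) :
    Omega a (stdContact n) :=
  ⟨f, fun x e he _ => by
    obtain rfl : e = OpenPartialHomeomorph.refl (Coord n) := chartedSpaceSelf_atlas.1 he
    exact (congrArg (fun g : Coord n → (Coord n) [⋀^Fin a]→L[ℝ] ℝ => ContDiffAt ℝ ∞ g x)
      (inChart_refl f)).mpr hf.contDiffAt⟩

/-- A smooth form on `ℝ^{2n+1}` as a function with values in alternating forms. -/
def formFun (θ : Omega a (stdContact n)) : Coord n → (Coord n) [⋀^Fin a]→L[ℝ] ℝ := θ.1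

theorem contDiff_formFun (θ : Omega a (stdContact n)) : ContDiff ℝ ∞ (formFun θ) := by
  rw [contDiff_iff_contDiffAt]
  intro x
  have h := θ.2 x (OpenPartialHomeomorph.refl (Coord n))
    (chartedSpaceSelf_atlas.2 rfl) (mem_univ x)
  exact (congrArg (fun g : Coord n → (Coord n) [⋀^Fin a]→L[ℝ] ℝ => ContDiffAt ℝ ∞ g x)
    (inChart_refl (formFun θ))).mp h

theorem formFun_injective : Function.Injective (formFun (n := n) (a := a)) :=
  fun _ _ h => Subtype.ext h

theorem formFun_formOf (f : Coord n → (Coord n) [⋀^Fin a]→L[ℝ] ℝ) (hf : ContDiff ℝ ∞ f) :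
    formFun (formOf f hf) = f := rfl

/-- Evaluation of forms on `ℝ^{2n+1}` at a point. -/
def evalForm (p : Coord n) : Omega a (stdContact n) →ₗ[ℝ] ((Coord n) [⋀^Fin a]→L[ℝ] ℝ) where
  toFun θ := formFun θ p
  map_add' _ _ := rfl
  map_smul' _ _ := rfl

theorem evalForm_apply (p : Coord n) (θ : Omega a (stdContact n)) :
    evalForm p θ = formFun θ p := rfl

/-! ### Affine contactomorphisms: dilations and shears -/

/-- The affine contactomorphism `p ↦ L p + c` of `ℝ^{2n+1}`. -/
def affineContactomorphism (L : Coord n ≃L[ℝ] Coord n) (c : Coord n)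
    (h : ∀ p v, stdLin n (L p + c) (L v) = 0 ↔ stdLin n p v = 0) :
    LocalContactomorphism (stdContact n) (stdContact n) where
  toFun := fun p : Coord n => L p + c
  localDiffeo := by
    let Ψ : Diffeomorph 𝓘(ℝ, Coord n) 𝓘(ℝ, Coord n) (Coord n) (Coord n) ∞ :=
      { toFun := fun p => L p + c
        invFun := fun q => L.symm (q - c)
        left_inv := fun p => by simp
        right_inv := fun q => by simp
        contMDiff_toFun := (L.contDiff.add contDiff_const).contMDiff
        contMDiff_invFun := (L.symm.contDiff.comp (contDiff_id.sub contDiff_const)).contMDiff }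
    exact Ψ.isLocalDiffeomorph
  map_Q := by
    intro (x : Coord n)
    have hd : (mfderiv 𝓘(ℝ, Coord n) 𝓘(ℝ, Coord n) (fun p : Coord n => L p + c) x :
        Coord n →L[ℝ] Coord n) = (L : Coord n →L[ℝ] Coord n) := by
      rw [mfderiv_eq_fderiv, fderiv_add_const]
      exact L.fderiv
    change Submodule.map (mfderiv 𝓘(ℝ, Coord n) 𝓘(ℝ, Coord n) (fun p : Coord n => L p + c) x :
        Coord n →L[ℝ] Coord n).toLinearMap (LinearMap.ker (stdLin n x).toLinearMap) =
      LinearMap.ker (stdLin n (L x + c)).toLinearMap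
    rw [hd]
    ext w
    constructor
    · rintro ⟨v, hv, rfl⟩
      exact (h x v).2 hv
    · intro hw
      have hw' : stdLin n (L x + c) (L (L.symm w)) = 0 :=
        (congrArg (stdLin n (L x + c)) (L.apply_symm_apply w)).trans hw
      exact ⟨L.symm w, (h x _).1 hw', L.apply_symm_apply w⟩

theorem formFun_affineContactomorphism_pull (L : Coord n ≃L[ℝ] Coord n) (c : Coord n)
    (h : ∀ p v, stdLin n (L p + c) (L v) = 0 ↔ stdLin n p v = 0) (θ : Omega a (stdContact n))
    (p : Coord n) :
    formFun ((affineContactomorphism L c h).pull a θ) p =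
      (formFun θ (L p + c)).compContinuousLinearMap (L : Coord n →L[ℝ] Coord n) := by
  have hd : (mfderiv 𝓘(ℝ, Coord n) 𝓘(ℝ, Coord n) (fun p : Coord n => L p + c) p :
      Coord n →L[ℝ] Coord n) = (L : Coord n →L[ℝ] Coord n) := by
    rw [mfderiv_eq_fderiv, fderiv_add_const]
    exact L.fderiv
  exact congrArg (fun M : Coord n →L[ℝ] Coord n =>
    (formFun θ (L p + c)).compContinuousLinearMap M) hd

/-- The dilation `(x, y, z) ↦ (c x, c y, c² z)`. -/
def dilation (n : ℕ) (c : ℝ) : Coord n →L[ℝ] Coord n :=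
  (c • ContinuousLinearMap.fst ℝ _ _).prod
    ((c • (ContinuousLinearMap.fst ℝ _ _ ∘L ContinuousLinearMap.snd ℝ _ _)).prod
      (c ^ 2 • (ContinuousLinearMap.snd ℝ _ _ ∘L ContinuousLinearMap.snd ℝ _ _)))

theorem dilation_apply (n : ℕ) (c : ℝ) (v : Coord n) :
    dilation n c v = (c • v.1, c • v.2.1, c ^ 2 * v.2.2) := rfl

/-- The contraction `(x, y, z) ↦ (x / 2, y / 2, z / 4)`. -/
def contraction (n : ℕ) : Coord n ≃L[ℝ] Coord n :=
  ContinuousLinearEquiv.equivOfInverse (dilation n (1 / 2)) (dilation n 2)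
    (fun v => by ext <;> simp [dilation_apply])
    (fun v => by ext <;> simp [dilation_apply])

theorem contraction_apply (n : ℕ) (v : Coord n) : contraction n v = dilation n (1 / 2) v := rfl

theorem norm_contraction_le (n : ℕ) : ‖(contraction n : Coord n →L[ℝ] Coord n)‖ ≤ 1 / 2 := by
  refine ContinuousLinearMap.opNorm_le_bound _ (by norm_num) fun v => ?_
  have h1 : ‖v.1‖ ≤ ‖v‖ := norm_fst_le v
  have h2 : ‖v.2.1‖ ≤ ‖v‖ := (norm_fst_le v.2).trans (norm_snd_le v)
  have h3 : ‖v.2.2‖ ≤ ‖v‖ := (norm_snd_le v.2).trans (norm_snd_le v)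
  change ‖dilation n (1 / 2) v‖ ≤ _
  rw [dilation_apply, Prod.norm_def, Prod.norm_def, norm_smul, norm_smul, norm_mul]
  have h4 : ‖(1 / 2 : ℝ)‖ = 1 / 2 := by norm_num
  have h5 : ‖(1 / 2 : ℝ) ^ 2‖ = 1 / 4 := by norm_num
  rw [h4, h5]
  have := norm_nonneg v
  refine max_le (by linarith) (max_le (by linarith) (by linarith))

/-- Both dz and x_i dy_i are multiplied by 1/4, hence so is the contact form; this is why z must
have weight 2. -/
theorem contraction_contact (n : ℕ) (p v : Coord n) :
    stdLin n (contraction n p + 0) (contraction n v) = 0 ↔ stdLin n p v = 0 := by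
  have : stdLin n (contraction n p + 0) (contraction n v) = (1 / 4) * stdLin n p v := by
    rw [add_zero, stdLin_apply, stdLin_apply, contraction_apply, contraction_apply,
      dilation_apply, dilation_apply, mul_add, Finset.mul_sum]
    congr 1
    · norm_num
    · refine Finset.sum_congr rfl fun i _ => ?_
      simp only [Pi.smul_apply, smul_eq_mul]
      ring
  rw [this]
  simp

/-- The weight of a coordinate direction under dilations. -/
def dirWeight {n : ℕ} : Fin n ⊕ Fin n ⊕ Unit → ℕ
  | .inl _ => 1
  | .inr (.inl _) => 1
  | .inr (.inr _) => 2

theorem dirWeight_le {n : ℕ} (i : Fin n ⊕ Fin n ⊕ Unit) : dirWeight i ≤ 2 := by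
  rcases i with i | i | i <;> simp [dirWeight]

theorem contraction_stdVec (n : ℕ) (i : Fin n ⊕ Fin n ⊕ Unit) :
    contraction n (stdVec n i) = (1 / 2 : ℝ) ^ dirWeight i • stdVec n i := by
  rcases i with i | i | i <;>
    simp [contraction_apply, dilation_apply, stdVec, dirWeight]

/-- The shear `(x, y, z) ↦ (x, y, z - ∑ i, c_i y_i)`. -/
def shearMap (c : Fin n → ℝ) : Coord n →L[ℝ] Coord n :=
  (ContinuousLinearMap.fst ℝ _ _).prod
    ((ContinuousLinearMap.fst ℝ _ _ ∘L ContinuousLinearMap.snd ℝ _ _).prod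
      (ContinuousLinearMap.snd ℝ _ _ ∘L ContinuousLinearMap.snd ℝ _ _ -
        ∑ i : Fin n, c i • (ContinuousLinearMap.proj (R := ℝ) (φ := fun _ : Fin n => ℝ) i ∘L
          ContinuousLinearMap.fst ℝ _ _ ∘L ContinuousLinearMap.snd ℝ _ _)))

theorem shearMap_apply (c : Fin n → ℝ) (v : Coord n) :
    shearMap c v = (v.1, v.2.1, v.2.2 - ∑ i, c i * v.2.1 i) :=
  Prod.ext rfl (Prod.ext rfl (by simp [shearMap]))

/-- The shear `(x, y, z) ↦ (x, y, z - ∑ i, c_i y_i)` as a linear equivalence. -/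
def shear (c : Fin n → ℝ) : Coord n ≃L[ℝ] Coord n :=
  ContinuousLinearEquiv.equivOfInverse (shearMap c) (shearMap (-c))
    (fun v => by ext <;> simp [shearMap_apply])
    (fun v => by ext <;> simp [shearMap_apply])

/-- Translation by p₀ adds ∑ x_i(p₀) dy_i to the contact form, and the shear removes exactly this
from dz. The form itself is preserved, not only its kernel. -/
theorem shear_contact (p₀ p v : Coord n) :
    stdLin n (shear p₀.1 p + p₀) (shear p₀.1 v) = 0 ↔ stdLin n p v = 0 := by
  have : stdLin n (shear p₀.1 p + p₀) (shear p₀.1 v) = stdLin n p v := by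
    change stdLin n (shearMap p₀.1 p + p₀) (shearMap p₀.1 v) = _
    simp only [stdLin_apply, shearMap_apply, Prod.fst_add, Pi.add_apply, add_mul,
      Finset.sum_add_distrib]
    ring
  rw [this]

/-- Pull-back by S has norm at most ‖S‖^a. The crude bound 1 suffices and is uniform in a, including
a = 0. -/
theorem norm_smul_compContinuousLinearMapCLM_le {E : Type} [NormedAddCommGroup E]
    [NormedSpace ℝ E] (a j : ℕ) (S : E →L[ℝ] E) (hS : ‖S‖ ≤ 1) :
    ‖(2 : ℝ) ^ j • (ContinuousAlternatingMap.compContinuousLinearMapCLM S :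
      (E [⋀^Fin a]→L[ℝ] ℝ) →L[ℝ] (E [⋀^Fin a]→L[ℝ] ℝ))‖ ≤ 2 ^ j := by
  refine ContinuousLinearMap.opNorm_le_bound _ (by positivity) fun η => ?_
  change ‖(2 : ℝ) ^ j • η.compContinuousLinearMap S‖ ≤ _
  rw [norm_smul, Real.norm_of_nonneg (by positivity)]
  gcongr
  refine (η.norm_compContinuousLinearMap_le S).trans ?_
  exact mul_le_of_le_one_right (norm_nonneg _) (pow_le_one₀ (norm_nonneg _) hS)

/-- Allows one tuple of basis vectors at a time, each of a definite weight under dilations. -/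
theorem alternating_eq_zero_of_stdVec {η : (Coord n) [⋀^Fin b]→L[ℝ] ℝ}
    (h : ∀ I : Fin b → Fin n ⊕ Fin n ⊕ Unit, η (fun j => stdVec n (I j)) = 0) : η = 0 := by
  have : η.toMultilinearMap = 0 :=
    Module.Basis.ext_multilinear (fun _ => stdBasis n) fun I => by
      simp only [stdBasis_apply]
      exact h I
  ext v
  exact congrArg (fun μ : MultilinearMap ℝ (fun _ : Fin b => Coord n) ℝ => μ v) this

/-! ### Dependence on the 2b-jet -/

/-- The values of `P θ` at the origin depend on the `2b`-jet of `θ` at the origin only. -/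
theorem NatContactMorphism.apply_zero_eq_zero (P : NatContactMorphism n a b)
    (θ : Omega a (stdContact n))
    (h : ∀ m ≤ 2 * b, iteratedFDeriv ℝ m (formFun θ) 0 = 0) :
    formFun (P.app (stdContact n) θ) 0 = 0 := by
  refine alternating_eq_zero_of_stdVec fun I => ?_
  set j := ∑ i, dirWeight (I i) with hj
  have hj2 : j ≤ 2 * b := by
    calc j ≤ ∑ _i : Fin b, 2 := Finset.sum_le_sum fun i _ => dirWeight_le (I i)
      _ = 2 * b := by simp [mul_comm]
  have hS := norm_contraction_le n
  obtain ⟨g, hg, hgeq⟩ := exists_contDiff_eq_add_comp (contDiff_formFun θ) j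
    (fun m hm => h m (hm.trans hj2)) _ hS _
    (norm_smul_compContinuousLinearMapCLM_le a j _ (hS.trans (by norm_num)))
  let φ := affineContactomorphism (contraction n) 0 (contraction_contact n)
  let G : Omega a (stdContact n) := formOf g hg
  -- `P` need not commute with infinite sums; this finite identity is all that has to be transported
  -- through it.
  have hG : G = θ + (2 : ℝ) ^ j • φ.pull a G := by
    refine formFun_injective (funext fun x => ?_)
    have h1 := formFun_affineContactomorphism_pull (contraction n) 0 (contraction_contact n) G x
    rw [add_zero] at h1
    refine (hgeq x).trans ?_
    change _ = formFun θ x + (2 : ℝ) ^ j • formFun (φ.pull a G) x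
    rw [h1]
    rfl
  have hP : P.app (stdContact n) G =
      P.app (stdContact n) θ + (2 : ℝ) ^ j • φ.pull b (P.app (stdContact n) G) := by
    rw [← P.naturality φ G, ← map_smul, ← map_add, ← hG]
  set ψ := P.app (stdContact n) G
  have h2 : formFun ψ 0 = formFun (P.app (stdContact n) θ) 0 +
      (2 : ℝ) ^ j • formFun (φ.pull b ψ) 0 :=
    congrArg (evalForm (0 : Coord n)) hP
  rw [formFun_affineContactomorphism_pull, add_zero, map_zero] at h2
  -- The origin is fixed, so pull-back only rescales this component, by 2^(-j). This cancels the 2^j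
  -- in `h2`, and the unknown component of ψ drops out.
  have h3 : (formFun ψ 0).compContinuousLinearMap (contraction n : Coord n →L[ℝ] Coord n)
      (fun i => stdVec n (I i)) = (1 / 2 : ℝ) ^ j * formFun ψ 0 (fun i => stdVec n (I i)) := by
    change (formFun ψ 0) (fun i => contraction n (stdVec n (I i))) = _
    simp only [contraction_stdVec]
    rw [hj, ← Finset.prod_pow_eq_pow_sum]
    exact (formFun ψ 0).toMultilinearMap.map_smul_univ _ _
  have h4 := congrArg (fun η : (Coord n) [⋀^Fin b]→L[ℝ] ℝ => η fun i => stdVec n (I i)) h2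
  simp only [ContinuousAlternatingMap.add_apply, ContinuousAlternatingMap.smul_apply, h3,
    smul_eq_mul, ← mul_assoc, ← mul_pow] at h4
  norm_num at h4
  exact h4

/-- The values of `P θ` at a point depend on the `2b`-jet of `θ` at this point only. -/
theorem NatContactMorphism.apply_eq_zero (P : NatContactMorphism n a b)
    (θ : Omega a (stdContact n)) (p : Coord n)
    (h : ∀ m ≤ 2 * b, iteratedFDeriv ℝ m (formFun θ) p = 0) :
    formFun (P.app (stdContact n) θ) p = 0 := by
  let φ := affineContactomorphism (shear p.1) p (shear_contact p)
  -- The contactomorphism sends 0 to p and is affine, so the m-th derivative of the pull-back at 0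
  -- is a linear image of that of θ at p.
  have h0 : formFun (P.app (stdContact n) (φ.pull a θ)) 0 = 0 := by
    refine P.apply_zero_eq_zero _ fun m hm => ?_
    let Φ : ((Coord n) [⋀^Fin a]→L[ℝ] ℝ) →L[ℝ] ((Coord n) [⋀^Fin a]→L[ℝ] ℝ) :=
      ContinuousAlternatingMap.compContinuousLinearMapCLM (shear p.1 : Coord n →L[ℝ] Coord n)
    have he : formFun (φ.pull a θ) = Φ ∘ ((fun q => formFun θ (q + p)) ∘
        (shear p.1 : Coord n →L[ℝ] Coord n)) :=
      funext fun q => formFun_affineContactomorphism_pull _ _ (shear_contact p) θ q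
    have hc : ContDiff ℝ ∞ (fun q => formFun θ (q + p)) :=
      (contDiff_formFun θ).comp (contDiff_id.add contDiff_const)
    have hle : ((m : ℕ∞) : WithTop ℕ∞) ≤ ∞ := by exact_mod_cast le_top
    rw [he, Φ.iteratedFDeriv_comp_left (hc.comp (ContinuousLinearMap.contDiff _)).contDiffAt hle,
      ContinuousLinearMap.iteratedFDeriv_comp_right _ hc _ hle, iteratedFDeriv_comp_add_right,
      map_zero, zero_add, h m hm]
    ext v
    simp
  rw [P.naturality, formFun_affineContactomorphism_pull, map_zero, zero_add] at h0
  ext v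
  have : formFun (P.app (stdContact n) θ) p
      (fun i => shear p.1 ((shear p.1).symm (v i))) = 0 :=
    congrArg (fun η : (Coord n) [⋀^Fin b]→L[ℝ] ℝ => η fun i => (shear p.1).symm (v i)) h0
  simpa using this

/-! ### Monomial expansion and the coefficients -/

/-- The coordinate functions of `ℝ^{2n+1}`. -/
def coordFun (n : ℕ) (i : Fin n ⊕ Fin n ⊕ Unit) : Coord n →L[ℝ] ℝ :=
  LinearMap.toContinuousLinearMap ((stdBasis n).coord i)

theorem sum_coordFun_smul_stdVec (v : Coord n) : ∑ i, coordFun n i v • stdVec n i = v := by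
  conv_rhs => rw [← (stdBasis n).sum_repr v]
  exact Finset.sum_congr rfl fun i _ => by rw [stdBasis_apply]; rfl

theorem multilinear_eq_sum_coordFun {G : Type*} [NormedAddCommGroup G] [NormedSpace ℝ G] {k : ℕ}
    (μ : ContinuousMultilinearMap ℝ (fun _ : Fin k => Coord n) G) (v : Coord n) :
    μ (fun _ => v) = ∑ I : Fin k → Fin n ⊕ Fin n ⊕ Unit,
      (∏ j, coordFun n (I j) v) • μ (fun j => stdVec n (I j)) := by
  conv_lhs => rw [← sum_coordFun_smul_stdVec v]
  rw [μ.map_sum]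
  exact Finset.sum_congr rfl fun I _ => μ.map_smul_univ _ _

/-- The coordinate monomial `∏ j ∈ J, ξ_{I j}`. -/
def coordMonomial {k : ℕ} (I : Fin k → Fin n ⊕ Fin n ⊕ Unit) (J : Finset (Fin k))
    (q : Coord n) : ℝ :=
  ∏ j ∈ J, coordFun n (I j) q

theorem contDiff_coordMonomial {k : ℕ} (I : Fin k → Fin n ⊕ Fin n ⊕ Unit) (J : Finset (Fin k)) :
    ContDiff ℝ ∞ (coordMonomial I J) :=
  contDiff_prod fun j _ => (coordFun n (I j)).contDiff

/-- The form `ξ^J η` with `ξ^J` a coordinate monomial and `η` a constant form. -/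
def monomialForm {k : ℕ} (I : Fin k → Fin n ⊕ Fin n ⊕ Unit) (J : Finset (Fin k)) :
    ((Coord n) [⋀^Fin a]→L[ℝ] ℝ) →ₗ[ℝ] Omega a (stdContact n) where
  toFun η := formOf (fun q => coordMonomial I J q • η)
    ((contDiff_coordMonomial I J).smul contDiff_const)
  map_add' η η' := formFun_injective (funext fun _ => smul_add _ η η')
  map_smul' c η := formFun_injective (funext fun _ => smul_comm _ c η)

/-- Separates p from q: `P` is only ℝ-linear, so p must enter through scalars multiplying forms that
do not depend on p. -/
theorem prod_coordFun_sub {k : ℕ} (I : Fin k → Fin n ⊕ Fin n ⊕ Unit) (p q : Coord n) :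
    ∏ j, coordFun n (I j) (q - p) =
      ∑ J : Finset (Fin k), coordMonomial I Jᶜ (-p) * coordMonomial I J q := by
  simp only [sub_eq_add_neg, map_add]
  rw [Finset.prod_add, Finset.powerset_univ]
  refine Finset.sum_congr rfl fun J _ => ?_
  rw [mul_comm, Finset.compl_eq_univ_sdiff]
  rfl

/-- The Taylor polynomial of a form as a sum of monomial forms. -/
theorem formOf_taylorPoly (θ : Omega a (stdContact n)) (r : ℕ) (p : Coord n) :
    formOf (taylorPoly (formFun θ) r p) (contDiff_taylorPoly _ r p) =
      ∑ k ∈ Finset.range (r + 1), ∑ I : Fin k → Fin n ⊕ Fin n ⊕ Unit, ∑ J : Finset (Fin k),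
        ((k.factorial : ℝ)⁻¹ * coordMonomial I Jᶜ (-p)) •
          monomialForm I J (partialDeriv I (formFun θ) p) := by
  refine formFun_injective (funext fun q => ?_)
  rw [formFun_formOf, ← evalForm_apply]
  simp only [map_sum, map_smul, taylorPoly]
  refine Finset.sum_congr rfl fun k _ => ?_
  rw [multilinear_eq_sum_coordFun, Finset.smul_sum]
  refine Finset.sum_congr rfl fun I _ => ?_
  rw [prod_coordFun_sub, Finset.sum_smul, Finset.smul_sum]
  refine Finset.sum_congr rfl fun J _ => ?_
  change _ = ((k.factorial : ℝ)⁻¹ * coordMonomial I Jᶜ (-p)) •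
    (coordMonomial I J q • partialDeriv I (formFun θ) p)
  rw [smul_smul, smul_smul, mul_assoc]
  rfl

/-- The coefficients of the differential operator given by a natural morphism. -/
def NatContactMorphism.coeff (P : NatContactMorphism n a b) (k : ℕ)
    (I : Fin k → Fin n ⊕ Fin n ⊕ Unit) (p : Coord n) :
    ((Coord n) [⋀^Fin a]→L[ℝ] ℝ) →L[ℝ] ((Coord n) [⋀^Fin b]→L[ℝ] ℝ) :=
  ∑ J : Finset (Fin k), ((k.factorial : ℝ)⁻¹ * coordMonomial I Jᶜ (-p)) •
    LinearMap.toContinuousLinearMap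
      (evalForm p ∘ₗ P.app (stdContact n) ∘ₗ monomialForm I J)

/-- For fixed η, the image of a monomial form is one smooth form independent of p; p enters only as
the point of evaluation and through polynomial factors. -/
theorem NatContactMorphism.contDiff_coeff (P : NatContactMorphism n a b) (k : ℕ)
    (I : Fin k → Fin n ⊕ Fin n ⊕ Unit) : ContDiff ℝ ∞ (P.coeff k I) := by
  rw [contDiff_clm_apply_iff]
  intro η
  have h : (fun p => P.coeff k I p η) = fun p => ∑ J : Finset (Fin k),
      ((k.factorial : ℝ)⁻¹ * coordMonomial I Jᶜ (-p)) •
        formFun (P.app (stdContact n) (monomialForm I J η)) p := by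
    funext p
    simp [NatContactMorphism.coeff, evalForm_apply]
  rw [h]
  refine ContDiff.sum fun J _ => ?_
  have hJ : ContDiff ℝ ∞ fun p : Coord n => (k.factorial : ℝ)⁻¹ * coordMonomial I Jᶜ (-p) :=
    contDiff_const.mul ((contDiff_coordMonomial I Jᶜ).comp contDiff_neg)
  exact hJ.smul (contDiff_formFun _)

/-- At fixed p, θ and its Taylor polynomial have the same 2b-jet, so their images under `P` agree at
p, though perhaps nowhere else. -/
theorem NatContactMorphism.formFun_app (P : NatContactMorphism n a b)
    (θ : Omega a (stdContact n)) (p : Coord n) :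
    formFun (P.app (stdContact n) θ) p = ∑ k ∈ Finset.range (2 * b + 1),
      ∑ I : Fin k → Fin n ⊕ Fin n ⊕ Unit, P.coeff k I p (partialDeriv I (formFun θ) p) := by
  set τ := formOf (taylorPoly (formFun θ) (2 * b) p) (contDiff_taylorPoly _ _ p) with hτ
  have h0 : evalForm p (P.app (stdContact n) (θ - τ)) = 0 := by
    refine P.apply_eq_zero _ p fun m hm => ?_
    change iteratedFDeriv ℝ m (formFun θ - taylorPoly (formFun θ) (2 * b) p) p = 0
    have hle : ((m : ℕ∞) : WithTop ℕ∞) ≤ ∞ := by exact_mod_cast le_top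
    rw [iteratedFDeriv_sub_apply ((contDiff_formFun θ).contDiffAt.of_le hle)
      ((contDiff_taylorPoly _ _ p).contDiffAt.of_le hle),
      iteratedFDeriv_taylorPoly (contDiff_formFun θ) _ p hm, sub_self]
  rw [show evalForm p (P.app (stdContact n) (θ - τ)) =
      evalForm p (P.app (stdContact n) θ) - evalForm p (P.app (stdContact n) τ) from
      (evalForm p ∘ₗ P.app (stdContact n)).map_sub θ τ, sub_eq_zero, hτ, formOf_taylorPoly] at h0
  rw [← evalForm_apply, h0]
  simp only [map_sum, map_smul]
  refine Finset.sum_congr rfl fun k _ => Finset.sum_congr rfl fun I _ => ?_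
  simp [NatContactMorphism.coeff]

end StandardForms

end ContactForms

end

theorem mainTheorem4 (n a b : ℕ) (P : ContactForms.NatContactMorphism n a b) :
    ∃ r : ℕ, ContactForms.IsDiffOpOfOrderLE r (P.app (ContactForms.stdContact n)) :=
  ⟨2 * b, P.coeff, P.contDiff_coeff, P.formFun_app⟩
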